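/- **Setting.** Let $X(r,\theta)=(r\cos\theta,r\sin\theta)$. Fix $\theta_0\in\mathbb R$ and let $r_1,r_2$ be positive continuous functions on $[\theta_0,\infty)$ with $r_2(\theta+2\pi)<r_1(\theta)<r_2(\theta)$ for all $\theta\ge\theta_0$ and $\lim_{\theta\to\infty}r_1(\theta)=\lim_{\theta\to\infty}r_2(\theta)=r_*$ for some $r_*>0$. Let $\bar R$ be a number with $r_2(\theta)\le\bar R$ for all $\theta\ge\theta_0$. Put $$U=\{X(r,\theta):\theta>\theta_0,\ r_1(\theta)<r<r_2(\theta)\},\qquad \widetilde U=\{X(r,\theta):\theta\ge\theta_0,\ r_1(\theta)\le r\le r_2(\theta)\},$$ $$\gamma=\{X(r_i(\theta),\theta):\theta\ge\theta_0,\ i=1,2\},\qquad \mathcal S_\theta=\{X(r,\theta):r_1(\theta)\le r\le r_2(\theta)\}\quad(\theta\ge\theta_0).$$ Let $A=(a_{ij})$ be a function from $U$ to the real symmetric $2\times2$ matrices and $b:U\to\mathbb R^2$, such that for constants $c_0>0$, $M_1>0$, $M_2\ge0$ and all $x\in U$, $\xi\in\mathbb R^2$, $$\xi^{\mathrm T}A(x)\xi\ge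 c_0|\xi|^2,\qquad \operatorname{Tr}A(x)\le M_1,\qquad |b(x)|\le M_2,$$ and let $Lu=-\sum_{i,j=1}^2a_{ij}\,\dfrac{\partial^2u}{\partial x_i\partial x_j}+b\cdot\nabla u$. Let $u\in C^2(U)\cap C(\widetilde U)$ be bounded on $\gamma$ and below exponential growth in $\widetilde U$, i.e. $\lim_{\theta\to\infty}e^{-\varepsilon\theta}\sup_{x\in\mathcal S_\theta}|u(x)|=0$ for every $\varepsilon>0$. Put $M_\gamma=\sup_\gamma u$, $m_\gamma=\inf_\gamma u$ and, for $\theta\ge\theta_0$, $$M_\gamma(\theta)=\max_{i=1,2}u(X(r_i(\theta),\theta)),\qquad m_\gamma(\theta)=\min_{i=1,2}u(X(r_i(\theta),\theta)).$$ **Theorem 5.1.** There are constants $C_*>0$ and $\nu>0$, depending only on $c_0,M_1,M_2,r_*,\bar R$ (in particular not on $u$), such that for all data as above the following hold. (i) If $Lu\le0$ in $U$, then $u$ is bounded above on $\widetilde U$ and $$\sup_{\widetilde U}u\le\sup_{\mathcal S_{\theta_0}\cup\gamma}u,$$ $$\max_{\mathcal S_\theta}u\le M_\gamma\bigl(1-C_*e^{-\nu(\theta-\theta_0)}\bigr)+C_*\Bigl(\sup_{\mathcal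 S_{\theta_0}\cup\gamma}u\Bigr)e^{-\nu(\theta-\theta_0)}\quad\text{for all }\theta\ge\theta_0,$$ $$\limsup_{\theta\to\infty}\Bigl(\max_{\mathcal S_\theta}u\Bigr)\le\limsup_{\theta\to\infty}M_\gamma(\theta).$$ (ii) If $Lu\ge0$ in $U$, then $u$ is bounded below on $\widetilde U$ and $$\inf_{\widetilde U}u\ge\inf_{\mathcal S_{\theta_0}\cup\gamma}u,$$ $$\min_{\mathcal S_\theta}u\ge m_\gamma\bigl(1-C_*e^{-\nu(\theta-\theta_0)}\bigr)+C_*\Bigl(\inf_{\mathcal S_{\theta_0}\cup\gamma}u\Bigr)e^{-\nu(\theta-\theta_0)}\quad\text{for all }\theta\ge\theta_0,$$ $$\liminf_{\theta\to\infty}\Bigl(\min_{\mathcal S_\theta}u\Bigr)\ge\liminf_{\theta\to\infty}m_\gamma(\theta).$$ -/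

import Mathlib

open scoped Topology

namespace SpiralDomain

/-- The Euclidean plane. -/
abbrev Plane : Type := EuclideanSpace ℝ (Fin 2)

/-- Polar coordinates `X(r, θ) = (r cos θ, r sin θ)`. -/
noncomputable def polar (r θ : ℝ) : Plane := !₂[r * Real.cos θ, r * Real.sin θ]

/-- The standing assumptions on the two boundary curves: `r₁, r₂` are positive and continuous on
`[θ₀, ∞)`, `r₂(θ + 2π) < r₁(θ) < r₂(θ)` there, and both converge to a number `r⋆ > 0`.
Only the values of `r₁, r₂` on `[θ₀, ∞)` matter. -/
structure IsSpiral (θ₀ : ℝ) (r₁ r₂ : ℝ → ℝ) (rstar : ℝ) : Prop where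
  continuousOn_r₁ : ContinuousOn r₁ (Set.Ici θ₀)
  continuousOn_r₂ : ContinuousOn r₂ (Set.Ici θ₀)
  r₁_pos : ∀ θ, θ₀ ≤ θ → 0 < r₁ θ
  r₂_pos : ∀ θ, θ₀ ≤ θ → 0 < r₂ θ
  r₂_shift_lt : ∀ θ, θ₀ ≤ θ → r₂ (θ + 2 * Real.pi) < r₁ θ
  r₁_lt_r₂ : ∀ θ, θ₀ ≤ θ → r₁ θ < r₂ θ
  rstar_pos : 0 < rstar
  tendsto_r₁ : Filter.Tendsto r₁ Filter.atTop (𝓝 rstar)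
  tendsto_r₂ : Filter.Tendsto r₂ Filter.atTop (𝓝 rstar)

/-- The open domain `U`. -/
def domU (θ₀ : ℝ) (r₁ r₂ : ℝ → ℝ) : Set Plane :=
  {x | ∃ r θ, θ₀ < θ ∧ r₁ θ < r ∧ r < r₂ θ ∧ x = polar r θ}

/-- The set `Ũ`, that is `U` together with the two boundary curves and the initial section (but
without the limit circle). -/
def domUtilde (θ₀ : ℝ) (r₁ r₂ : ℝ → ℝ) : Set Plane :=
  {x | ∃ r θ, θ₀ ≤ θ ∧ r₁ θ ≤ r ∧ r ≤ r₂ θ ∧ x = polar r θ}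

/-- The lateral boundary `γ = γ₁ ∪ γ₂`. -/
def lateral (θ₀ : ℝ) (r₁ r₂ : ℝ → ℝ) : Set Plane :=
  {x | ∃ θ, θ₀ ≤ θ ∧ x = polar (r₁ θ) θ} ∪ {x | ∃ θ, θ₀ ≤ θ ∧ x = polar (r₂ θ) θ}

/-- The cross-section `S_θ`. -/
def crossSection (r₁ r₂ : ℝ → ℝ) (θ : ℝ) : Set Plane :=
  {x | ∃ r, r₁ θ ≤ r ∧ r ≤ r₂ θ ∧ x = polar r θ}

/-- `max_{S_θ} u` (for `u` continuous on `Ũ` and `θ ≥ θ₀` the supremum is a maximum, as `S_θ` is a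
nonempty compact subset of `Ũ`). -/
noncomputable def sectionMax (r₁ r₂ : ℝ → ℝ) (u : Plane → ℝ) (θ : ℝ) : ℝ :=
  sSup (u '' crossSection r₁ r₂ θ)

/-- `min_{S_θ} u`. -/
noncomputable def sectionMin (r₁ r₂ : ℝ → ℝ) (u : Plane → ℝ) (θ : ℝ) : ℝ :=
  sInf (u '' crossSection r₁ r₂ θ)

/-- `M_γ(θ)`, the larger of the two values of `u` at the ends of `S_θ`. -/
noncomputable def endMax (r₁ r₂ : ℝ → ℝ) (u : Plane → ℝ) (θ : ℝ) : ℝ :=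
  max (u (polar (r₁ θ) θ)) (u (polar (r₂ θ) θ))

/-- `m_γ(θ)`, the smaller of the two values of `u` at the ends of `S_θ`. -/
noncomputable def endMin (r₁ r₂ : ℝ → ℝ) (u : Plane → ℝ) (θ : ℝ) : ℝ :=
  min (u (polar (r₁ θ) θ)) (u (polar (r₂ θ) θ))

/-- The partial derivative `∂u/∂xᵢ`. -/
noncomputable def pderiv (i : Fin 2) (u : Plane → ℝ) (x : Plane) : ℝ :=
  fderiv ℝ u x (EuclideanSpace.single i 1)

/-- The operator `L u = - ∑ aᵢⱼ ∂²u/∂xᵢ∂xⱼ + b · ∇u`. -/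
noncomputable def opL (A : Plane → Matrix (Fin 2) (Fin 2) ℝ) (b : Plane → Plane)
    (u : Plane → ℝ) (x : Plane) : ℝ :=
  -(∑ i, ∑ j, A x i j * pderiv i (pderiv j u) x) + ∑ i, b x i * pderiv i u x

/-- Symmetry and uniform ellipticity of `A` on `Ω` with constants `c₀` and `M₁`. -/
structure IsElliptic (Ω : Set Plane) (A : Plane → Matrix (Fin 2) (Fin 2) ℝ) (c₀ M₁ : ℝ) :
    Prop where
  symm : ∀ x ∈ Ω, (A x).IsSymm
  lower : ∀ x ∈ Ω, ∀ ξ : Plane, c₀ * ‖ξ‖ ^ 2 ≤ ∑ i, ∑ j, ξ i * A x i j * ξ j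
  trace_le : ∀ x ∈ Ω, (A x).trace ≤ M₁

/-- `u` is below exponential growth in `Ũ`: `e^{-ε θ} sup_{S_θ} |u| → 0` as `θ → ∞`, for every
`ε > 0`. -/
def BelowExpGrowth (r₁ r₂ : ℝ → ℝ) (u : Plane → ℝ) : Prop :=
  ∀ ε : ℝ, 0 < ε → Filter.Tendsto
    (fun θ : ℝ => Real.exp (-ε * θ) * sSup ((fun x => |u x|) '' crossSection r₁ r₂ θ))
    Filter.atTop (𝓝 0)

end SpiralDomain

open SpiralDomain

/-! Let w = B - exp(l x₀) be `weight`, where x₀ is the first coordinate. If l is large compared with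
the drift, L w is bounded below by a positive constant on |x| ≤ R. The angle θ has bounded gradient
and Hessian on the spiral, since successive turns decrease to the limit circle and so |x| ≥ r⋆ there
(`IsSpiral.rstar_le_r₁`). If h > 0 and |h'|, |h''| ≤ ν h with ν small, then in L(h(θ) w) = h L w +
O(ν h) the first term wins: m + h(θ) w is a strict supersolution (`opL_barrier_pos`). It lies above
u on a truncated strip once it does so on the boundary of the strip (`IsSpiralData.le_barrier`).

Take h = (N - m) e^{-ν(θ-θ₀)} + δ e^{νθ}, with m ≥ u on γ, N ≥ u on the initial section, and m ≤ N.
The first term handles the initial section, the second a distant section, by the growth condition.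
Letting δ → 0 gives u ≤ m + B (N - m) e^{-ν(θ-θ₀)} (`IsSpiralData.le_add_exp_decay`). Suitable
choices of m, N and of the starting angle give all of (i); (ii) is (i) for -u.

No global angle on the plane is needed: maxima are taken over the (r, θ) strip, and a smooth local
branch of the angle enters only near an interior maximum. -/

namespace SpiralDomain

/-! ### Partial derivatives and the second-order condition at a maximum. -/

section Calculus

variable {f g : Plane → ℝ} {x : Plane}

theorem pderiv_mul (i : Fin 2) (hf : DifferentiableAt ℝ f x) (hg : DifferentiableAt ℝ g x) :
    pderiv i (fun y => f y * g y) x = f x * pderiv i g x + g x * pderiv i f x := by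
  simp [pderiv, fderiv_fun_mul hf hg]

theorem pderiv_add (i : Fin 2) (hf : DifferentiableAt ℝ f x) (hg : DifferentiableAt ℝ g x) :
    pderiv i (fun y => f y + g y) x = pderiv i f x + pderiv i g x := by
  simp [pderiv, fderiv_fun_add hf hg]

theorem pderiv_sub (i : Fin 2) (hf : DifferentiableAt ℝ f x) (hg : DifferentiableAt ℝ g x) :
    pderiv i (fun y => f y - g y) x = pderiv i f x - pderiv i g x := by
  simp [pderiv, fderiv_fun_sub hf hg]

theorem pderiv_neg (i : Fin 2) (f : Plane → ℝ) (x : Plane) :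
    pderiv i (fun y => -f y) x = -pderiv i f x := by
  simp [pderiv]

theorem pderiv_comp (i : Fin 2) {h : ℝ → ℝ} {h' : ℝ} (hh : HasDerivAt h h' (f x))
    (hf : DifferentiableAt ℝ f x) : pderiv i (fun y => h (f y)) x = h' * pderiv i f x := by
  have := (hh.comp_hasFDerivAt x hf.hasFDerivAt).fderiv
  simp only [Function.comp_def] at this
  simp [pderiv, this]

theorem pderiv_const (i : Fin 2) (c : ℝ) (x : Plane) : pderiv i (fun _ => c) x = 0 := by
  simp [pderiv]

theorem pderiv_coord (i j : Fin 2) (x : Plane) :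
    pderiv i (fun y => y j) x = if j = i then 1 else 0 := by
  have : fderiv ℝ (fun y : Plane => y j) x = EuclideanSpace.proj j :=
    (EuclideanSpace.proj (𝕜 := ℝ) j).hasFDerivAt.fderiv
  simp [pderiv, this]

theorem pderiv_congr (i : Fin 2) (h : f =ᶠ[𝓝 x] g) : pderiv i f x = pderiv i g x := by
  simp [pderiv, h.fderiv_eq]

theorem eventually_differentiableAt (hf : ContDiffAt ℝ 2 f x) :
    ∀ᶠ y in 𝓝 x, DifferentiableAt ℝ f y :=
  (hf.eventually (by simp)).mono fun _ hy => hy.differentiableAt (by simp)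

theorem differentiableAt_pderiv (i : Fin 2) (hf : ContDiffAt ℝ 2 f x) :
    DifferentiableAt ℝ (pderiv i f) x := by
  have h := (hf.fderiv_right (m := 1) (by norm_num)).differentiableAt (by simp)
  exact h.clm_apply (differentiableAt_const _)

theorem pderiv_pderiv_mul (i j : Fin 2) (hf : ContDiffAt ℝ 2 f x) (hg : ContDiffAt ℝ 2 g x) :
    pderiv i (pderiv j fun y => f y * g y) x =
      f x * pderiv i (pderiv j g) x + pderiv i f x * pderiv j g x +
        pderiv j f x * pderiv i g x + g x * pderiv i (pderiv j f) x := by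
  have h : (pderiv j fun y => f y * g y) =ᶠ[𝓝 x]
      fun y => f y * pderiv j g y + g y * pderiv j f y := by
    filter_upwards [eventually_differentiableAt hf, eventually_differentiableAt hg] with y h1 h2
    exact pderiv_mul j h1 h2
  have hf1 := hf.differentiableAt (by simp)
  have hg1 := hg.differentiableAt (by simp)
  have hf2 := differentiableAt_pderiv j hf
  have hg2 := differentiableAt_pderiv j hg
  rw [pderiv_congr i h, pderiv_add i (hf1.fun_mul hg2) (hg1.fun_mul hf2), pderiv_mul i hf1 hg2,
    pderiv_mul i hg1 hf2]
  ring

theorem pderiv_pderiv_add (i j : Fin 2) (hf : ContDiffAt ℝ 2 f x) (hg : ContDiffAt ℝ 2 g x) :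
    pderiv i (pderiv j fun y => f y + g y) x =
      pderiv i (pderiv j f) x + pderiv i (pderiv j g) x := by
  have h : (pderiv j fun y => f y + g y) =ᶠ[𝓝 x] fun y => pderiv j f y + pderiv j g y := by
    filter_upwards [eventually_differentiableAt hf, eventually_differentiableAt hg] with y h1 h2
    exact pderiv_add j h1 h2
  rw [pderiv_congr i h,
    pderiv_add i (differentiableAt_pderiv j hf) (differentiableAt_pderiv j hg)]

theorem pderiv_pderiv_sub (i j : Fin 2) (hf : ContDiffAt ℝ 2 f x) (hg : ContDiffAt ℝ 2 g x) :
    pderiv i (pderiv j fun y => f y - g y) x =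
      pderiv i (pderiv j f) x - pderiv i (pderiv j g) x := by
  have h : (pderiv j fun y => f y - g y) =ᶠ[𝓝 x] fun y => pderiv j f y - pderiv j g y := by
    filter_upwards [eventually_differentiableAt hf, eventually_differentiableAt hg] with y h1 h2
    exact pderiv_sub j h1 h2
  rw [pderiv_congr i h,
    pderiv_sub i (differentiableAt_pderiv j hf) (differentiableAt_pderiv j hg)]

theorem pderiv_pderiv_comp (i j : Fin 2) {h h' h'' : ℝ → ℝ} (h1 : ∀ t, HasDerivAt h (h' t) t)
    (h2 : ∀ t, HasDerivAt h' (h'' t) t) (hf : ContDiffAt ℝ 2 f x) :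
    pderiv i (pderiv j fun y => h (f y)) x =
      h'' (f x) * pderiv i f x * pderiv j f x + h' (f x) * pderiv i (pderiv j f) x := by
  have h : (pderiv j fun y => h (f y)) =ᶠ[𝓝 x] fun y => h' (f y) * pderiv j f y := by
    filter_upwards [eventually_differentiableAt hf] with y hy
    exact pderiv_comp j (h1 _) hy
  have hf1 := hf.differentiableAt (by simp)
  have hd : DifferentiableAt ℝ (fun y => h' (f y)) x :=
    (h2 (f x)).differentiableAt.comp x hf1
  rw [pderiv_congr i h, pderiv_mul i hd (differentiableAt_pderiv j hf), pderiv_comp i (h2 _) hf1]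
  ring

theorem opL_sub (A : Plane → Matrix (Fin 2) (Fin 2) ℝ) (b : Plane → Plane)
    (hf : ContDiffAt ℝ 2 f x) (hg : ContDiffAt ℝ 2 g x) :
    opL A b (fun y => f y - g y) x = opL A b f x - opL A b g x := by
  simp only [opL, Fin.sum_univ_two, pderiv_pderiv_sub _ _ hf hg,
    pderiv_sub _ (hf.differentiableAt (by simp)) (hg.differentiableAt (by simp))]
  ring

theorem opL_neg (A : Plane → Matrix (Fin 2) (Fin 2) ℝ) (b : Plane → Plane) (f : Plane → ℝ)
    (x : Plane) : opL A b (fun y => -f y) x = -opL A b f x := by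
  have h (j : Fin 2) : (pderiv j fun y => -f y) = fun y => -pderiv j f y :=
    funext fun y => pderiv_neg j f y
  simp only [opL, Fin.sum_univ_two, h, pderiv_neg]
  ring

/-- The second derivative along a line is nonpositive at a local maximum. -/
theorem deriv_deriv_nonpos_of_isLocalMax {φ : ℝ → ℝ} {t : ℝ} (h : IsLocalMax φ t)
    (hc : ContinuousAt φ t) : deriv (deriv φ) t ≤ 0 := by
  by_contra! hpos
  -- A positive second derivative makes t a local minimum too, so φ is locally constant and the
  -- second derivative vanishes.
  have hmin := isLocalMin_of_deriv_deriv_pos hpos h.deriv_eq_zero hc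
  have hconst : φ =ᶠ[𝓝 t] fun _ => φ t := by
    filter_upwards [h, hmin] with s h1 h2 using le_antisymm h1 h2
  have h1 : deriv φ =ᶠ[𝓝 t] fun _ => 0 := by
    refine hconst.deriv.trans (Filter.Eventually.of_forall fun s => ?_)
    simp
  rw [h1.deriv_eq] at hpos
  simp at hpos

theorem fderiv_apply_eq (f : Plane → ℝ) (x ξ : Plane) :
    fderiv ℝ f x ξ = ∑ i, ξ i * pderiv i f x := by
  have hξ : ξ = ∑ i, ξ i • EuclideanSpace.single i (1 : ℝ) := by
    ext k
    fin_cases k <;> simp [Fin.sum_univ_two]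
  conv_lhs => rw [hξ]
  simp [pderiv]

/-- Restrict f to the line x + tξ: the quadratic form is the second derivative of the restriction at
t = 0. -/
theorem hessian_nonpos_of_isLocalMax (hf : ContDiffAt ℝ 2 f x) (h : IsLocalMax f x) (ξ : Plane) :
    ∑ i, ∑ j, ξ i * ξ j * pderiv i (pderiv j f) x ≤ 0 := by
  have hline : ∀ t : ℝ, HasDerivAt (fun t : ℝ => x + t • ξ) ξ t := fun t => by
    simpa using ((hasDerivAt_id t).smul_const ξ).const_add x
  have hx0 : x + (0 : ℝ) • ξ = x := by simp
  have hcont : Filter.Tendsto (fun t : ℝ => x + t • ξ) (𝓝 0) (𝓝 x) := by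
    have := (hline 0).continuousAt.tendsto
    rwa [hx0] at this
  have hmax : IsLocalMax (fun t : ℝ => f (x + t • ξ)) 0 := by
    have := hcont.eventually h
    simpa [IsLocalMax, IsMaxFilter] using this
  have h1 : deriv (fun t : ℝ => f (x + t • ξ)) =ᶠ[𝓝 0]
      fun t => ∑ j, ξ j * pderiv j f (x + t • ξ) := by
    filter_upwards [hcont.eventually (eventually_differentiableAt hf)] with t ht
    rw [← fderiv_apply_eq]
    exact (ht.hasFDerivAt.comp_hasDerivAt t (hline t)).deriv
  have h2 : ∀ j, HasDerivAt (fun t : ℝ => pderiv j f (x + t • ξ))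
      (∑ i, ξ i * pderiv i (pderiv j f) x) 0 := fun j => by
    have hd := (differentiableAt_pderiv j hf).hasFDerivAt
    rw [← fderiv_apply_eq]
    rw [← hx0] at hd
    have := hd.comp_hasDerivAt (0 : ℝ) (hline 0)
    rwa [hx0] at this
  have hcf : ContinuousAt (fun t : ℝ => f (x + t • ξ)) 0 := by
    have hc := hf.continuousAt
    rw [← hx0] at hc
    exact ContinuousAt.comp (f := fun t : ℝ => x + t • ξ) hc (hline 0).continuousAt
  have key := deriv_deriv_nonpos_of_isLocalMax hmax hcf
  rw [h1.deriv_eq,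
    (HasDerivAt.fun_sum fun j _ => (h2 j).const_mul (ξ j)).deriv] at key
  simp only [Fin.sum_univ_two] at key ⊢
  linarith

/-- At a local maximum an elliptic operator without zeroth-order term is nonnegative. -/
theorem opL_nonneg_of_isLocalMax {A : Plane → Matrix (Fin 2) (Fin 2) ℝ} (b : Plane → Plane)
    {c₀ : ℝ} (hc₀ : 0 < c₀) (hsymm : (A x).IsSymm)
    (hA : ∀ ξ : Plane, c₀ * ‖ξ‖ ^ 2 ≤ ∑ i, ∑ j, ξ i * A x i j * ξ j)
    (hf : ContDiffAt ℝ 2 f x) (h : IsLocalMax f x) : 0 ≤ opL A b f x := by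
  have hgrad : ∀ i, pderiv i f x = 0 := fun i => by simp [pderiv, h.fderiv_eq_zero]
  have hs : A x 1 0 = A x 0 1 := by simpa using congrFun (congrFun hsymm 0) 1
  -- Completing the square replaces diagonalisation: a₀₀ Tr(A D²f) is D²f evaluated on (a₀₀, a₀₁)
  -- plus det A · ∂₁∂₁f. The vector (-a₀₁, a₀₀) in the ellipticity bound yields a₀₀ det A ≥ 0.
  have e1 := hA !₂[1, 0]
  have e2 := hA !₂[-A x 0 1, A x 0 0]
  have q1 := hessian_nonpos_of_isLocalMax hf h !₂[A x 0 0, A x 0 1]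
  have q2 := hessian_nonpos_of_isLocalMax hf h !₂[0, 1]
  simp only [opL, hgrad, Fin.sum_univ_two, EuclideanSpace.norm_sq_eq, hs] at e1 e2 q1 q2 ⊢
  simp at e1 e2 q1 q2 ⊢
  have ha : 0 < A x 0 0 := by linarith
  have hdet : 0 ≤ A x 0 0 * A x 1 1 - A x 0 1 ^ 2 := by
    have : 0 ≤ A x 0 0 * (A x 0 0 * A x 1 1 - A x 0 1 ^ 2) := by
      have : 0 ≤ c₀ * (A x 0 1 ^ 2 + A x 0 0 ^ 2) := by positivity
      nlinarith
    exact nonneg_of_mul_nonneg_right this ha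
  have q3 := mul_nonneg hdet (neg_nonneg.2 q2)
  refine nonneg_of_mul_nonneg_right ?_ ha
  nlinarith

theorem pderiv_div (i : Fin 2) (hf : DifferentiableAt ℝ f x) (hg : DifferentiableAt ℝ g x)
    (h0 : g x ≠ 0) :
    pderiv i (fun y => f y / g y) x =
      (pderiv i f x * g x - f x * pderiv i g x) / g x ^ 2 := by
  have hinv : DifferentiableAt ℝ (fun y => (g y)⁻¹) x := hg.fun_inv h0
  simp only [div_eq_mul_inv]
  rw [pderiv_mul i hf hinv, pderiv_comp i (hasDerivAt_inv h0) hg]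
  field_simp
  ring

theorem pderiv_const_mul (i : Fin 2) (c : ℝ) (hf : DifferentiableAt ℝ f x) :
    pderiv i (fun y => c * f y) x = c * pderiv i f x := by
  rw [pderiv_mul i (differentiableAt_const c) hf, pderiv_const]
  ring

theorem contDiff_coord (i : Fin 2) {n : WithTop ℕ∞} : ContDiff ℝ n fun x : Plane => x i :=
  (EuclideanSpace.proj (𝕜 := ℝ) i).contDiff

theorem differentiableAt_coord (i : Fin 2) : DifferentiableAt ℝ (fun x : Plane => x i) x :=
  (contDiff_coord i (n := 1)).differentiable (by simp) x

end Calculus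

/-! ### Local branches of the polar angle. -/

section Angle

/-- The smooth branch of the polar angle which equals `φ` on the ray of direction `φ`; it is
meaningful on the half-plane of points with a positive component along that ray. -/
noncomputable def angle (φ : ℝ) (x : Plane) : ℝ :=
  φ + Real.arctan ((Real.cos φ * x 1 - Real.sin φ * x 0) / (Real.cos φ * x 0 + Real.sin φ * x 1))

/-- The open half-plane on which `angle φ` is used. -/
def halfPlane (φ : ℝ) : Set Plane := {x | 0 < Real.cos φ * x 0 + Real.sin φ * x 1}

variable {φ : ℝ} {x : Plane}

theorem isOpen_halfPlane (φ : ℝ) : IsOpen (halfPlane φ) := by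
  refine isOpen_lt continuous_const ?_
  fun_prop

theorem sq_add_sq_pos_of_mem_halfPlane (hx : x ∈ halfPlane φ) : 0 < x 0 ^ 2 + x 1 ^ 2 := by
  by_contra! h
  have h0 : x 0 = 0 := by nlinarith [sq_nonneg (x 0), sq_nonneg (x 1)]
  have h1 : x 1 = 0 := by nlinarith [sq_nonneg (x 0), sq_nonneg (x 1)]
  simp [halfPlane, h0, h1] at hx

theorem contDiffAt_angle {n : WithTop ℕ∞} (hx : x ∈ halfPlane φ) :
    ContDiffAt ℝ n (angle φ) x := by
  have h0 := (contDiff_coord 0 (n := n)).contDiffAt (x := x)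
  have h1 := (contDiff_coord 1 (n := n)).contDiffAt (x := x)
  have hc : ∀ c : ℝ, ContDiffAt ℝ n (fun _ : Plane => c) x := fun c => contDiffAt_const
  exact (hc φ).add <| Real.contDiff_arctan.contDiffAt.comp x <|
    (((hc _).mul h1).sub ((hc _).mul h0)).div (((hc _).mul h0).add ((hc _).mul h1)) hx.ne'

/-- Numerator and denominator in `angle` are the coordinates of x in the frame rotated by φ, so
their squares sum to |x|² and φ cancels. -/
theorem pderiv_angle (hx : x ∈ halfPlane φ) :
    pderiv 0 (angle φ) x = -x 1 / (x 0 ^ 2 + x 1 ^ 2) ∧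
      pderiv 1 (angle φ) x = x 0 / (x 0 ^ 2 + x 1 ^ 2) := by
  have d (i : Fin 2) := differentiableAt_coord i (x := x)
  have dc (c : ℝ) (i : Fin 2) : DifferentiableAt ℝ (fun y : Plane => c * y i) x :=
    (d i).const_mul c
  have hD : Real.cos φ * x 0 + Real.sin φ * x 1 ≠ 0 := ne_of_gt hx
  have dN := (dc (Real.cos φ) 1).fun_sub (dc (Real.sin φ) 0)
  have dD := (dc (Real.cos φ) 0).fun_add (dc (Real.sin φ) 1)
  have hr := (sq_add_sq_pos_of_mem_halfPlane hx).ne'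
  have hcs := Real.sin_sq_add_cos_sq φ
  have alg (N D R P Q : ℝ) (hD : D ≠ 0) (hR : R ≠ 0) (h : D ^ 2 + N ^ 2 = R) :
      1 / (1 + (N / D) ^ 2) * ((P * D - N * Q) / D ^ 2) = (P * D - N * Q) / R := by
    have : 1 + (N / D) ^ 2 = R / D ^ 2 := by
      rw [← h]
      field_simp
    rw [this]
    field_simp
  have key (i : Fin 2) : pderiv i (angle φ) x =
      (pderiv i (fun y => Real.cos φ * y 1 - Real.sin φ * y 0) x *
          (Real.cos φ * x 0 + Real.sin φ * x 1) -
        (Real.cos φ * x 1 - Real.sin φ * x 0) *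
          pderiv i (fun y => Real.cos φ * y 0 + Real.sin φ * y 1) x) / (x 0 ^ 2 + x 1 ^ 2) := by
    unfold angle
    have dq : DifferentiableAt ℝ (fun y : Plane => (Real.cos φ * y 1 - Real.sin φ * y 0) /
        (Real.cos φ * y 0 + Real.sin φ * y 1)) x := by
      simpa only [div_eq_mul_inv] using dN.fun_mul (dD.fun_inv hD)
    rw [pderiv_add i (differentiableAt_const φ) (dq.arctan),
      pderiv_const, pderiv_comp i (Real.hasDerivAt_arctan _) dq, pderiv_div i dN dD hD]
    have hsum : (Real.cos φ * x 0 + Real.sin φ * x 1) ^ 2 +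
        (Real.cos φ * x 1 - Real.sin φ * x 0) ^ 2 = x 0 ^ 2 + x 1 ^ 2 := by
      linear_combination (x 0 ^ 2 + x 1 ^ 2) * hcs
    rw [zero_add]
    exact alg _ _ _ _ _ hD hr hsum
  rw [key, key, pderiv_sub _ (dc _ 1) (dc _ 0), pderiv_add _ (dc _ 0) (dc _ 1),
    pderiv_sub _ (dc _ 1) (dc _ 0), pderiv_add _ (dc _ 0) (dc _ 1)]
  simp only [pderiv_const_mul _ _ (d _), pderiv_coord]
  constructor
  · congr 1
    simp
    linear_combination -x 1 * hcs
  · congr 1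
    simp
    linear_combination x 0 * hcs

theorem pderiv_pderiv_angle (hx : x ∈ halfPlane φ) :
    pderiv 0 (pderiv 0 (angle φ)) x = 2 * x 0 * x 1 / (x 0 ^ 2 + x 1 ^ 2) ^ 2 ∧
    pderiv 0 (pderiv 1 (angle φ)) x = (x 1 ^ 2 - x 0 ^ 2) / (x 0 ^ 2 + x 1 ^ 2) ^ 2 ∧
    pderiv 1 (pderiv 0 (angle φ)) x = (x 1 ^ 2 - x 0 ^ 2) / (x 0 ^ 2 + x 1 ^ 2) ^ 2 ∧
    pderiv 1 (pderiv 1 (angle φ)) x = -(2 * x 0 * x 1) / (x 0 ^ 2 + x 1 ^ 2) ^ 2 := by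
  have hev := (isOpen_halfPlane φ).eventually_mem hx
  have e0 : pderiv 0 (angle φ) =ᶠ[𝓝 x] fun y => -y 1 / (y 0 ^ 2 + y 1 ^ 2) := by
    filter_upwards [hev] with y hy using (pderiv_angle hy).1
  have e1 : pderiv 1 (angle φ) =ᶠ[𝓝 x] fun y => y 0 / (y 0 ^ 2 + y 1 ^ 2) := by
    filter_upwards [hev] with y hy using (pderiv_angle hy).2
  have d (i : Fin 2) := differentiableAt_coord i (x := x)
  have dn : DifferentiableAt ℝ (fun y : Plane => -y 1) x := (d 1).fun_neg
  have dsq (i : Fin 2) : DifferentiableAt ℝ (fun y : Plane => y i ^ 2) x := (d i).fun_pow 2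
  have hr := (sq_add_sq_pos_of_mem_halfPlane hx).ne'
  have hD := (dsq 0).fun_add (dsq 1)
  have hsq (i j : Fin 2) : pderiv i (fun y : Plane => y j ^ 2) x =
      2 * x j * if j = i then 1 else 0 := by
    rw [pderiv_comp (h := fun t => t ^ 2) i (hasDerivAt_pow 2 (x j)) (d j), pderiv_coord]
    simp
  have a (i : Fin 2) : pderiv i (fun y : Plane => y 0 ^ 2 + y 1 ^ 2) x = 2 * x i := by
    rw [pderiv_add i (dsq 0) (dsq 1), hsq, hsq]
    fin_cases i <;> simp
  refine ⟨?_, ?_, ?_, ?_⟩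
  · rw [pderiv_congr 0 e0, pderiv_div 0 dn hD hr, a, pderiv_neg, pderiv_coord]
    simp
    ring
  · rw [pderiv_congr 0 e1, pderiv_div 0 (d 0) hD hr, a, pderiv_coord]
    simp
    ring
  · rw [pderiv_congr 1 e0, pderiv_div 1 dn hD hr, a, pderiv_neg, pderiv_coord]
    simp
    ring
  · rw [pderiv_congr 1 e1, pderiv_div 1 (d 0) hD hr, a, pderiv_coord]
    simp
    ring

/-- Here D and N are the coordinates in the rotated frame, so arctan (N / D) is the angle from the
ray of direction φ, with cosine D / |x|. -/
theorem polar_angle (hx : x ∈ halfPlane φ) : polar ‖x‖ (angle φ x) = x := by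
  have hD : 0 < Real.cos φ * x 0 + Real.sin φ * x 1 := hx
  have hcs := Real.sin_sq_add_cos_sq φ
  set D := Real.cos φ * x 0 + Real.sin φ * x 1 with hDdef
  set N := Real.cos φ * x 1 - Real.sin φ * x 0 with hNdef
  have hnorm : ‖x‖ = D * √(1 + (N / D) ^ 2) := by
    rw [EuclideanSpace.norm_eq, Fin.sum_univ_two, Real.norm_eq_abs, Real.norm_eq_abs, sq_abs,
      sq_abs]
    have : x 0 ^ 2 + x 1 ^ 2 = D ^ 2 * (1 + (N / D) ^ 2) := by
      field_simp
      rw [hDdef, hNdef]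
      linear_combination -(x 0 ^ 2 + x 1 ^ 2) * hcs
    rw [this, Real.sqrt_mul (sq_nonneg D), Real.sqrt_sq hD.le]
  have hs : 0 < √(1 + (N / D) ^ 2) := by positivity
  have h0 : ‖x‖ * Real.cos (angle φ x) = x 0 := by
    rw [angle, Real.cos_add, Real.cos_arctan, Real.sin_arctan, hnorm, ← hDdef, ← hNdef]
    field_simp
    rw [hDdef, hNdef]
    linear_combination x 0 * hcs
  have h1 : ‖x‖ * Real.sin (angle φ x) = x 1 := by
    rw [angle, Real.sin_add, Real.cos_arctan, Real.sin_arctan, hnorm, ← hDdef, ← hNdef]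
    field_simp
    rw [hDdef, hNdef]
    linear_combination x 1 * hcs
  ext i
  fin_cases i <;> simp [polar, h0, h1]

theorem polar_mem_halfPlane {r : ℝ} (hr : 0 < r) : polar r φ ∈ halfPlane φ := by
  have : Real.cos φ * (r * Real.cos φ) + Real.sin φ * (r * Real.sin φ) = r := by
    linear_combination r * Real.sin_sq_add_cos_sq φ
  simpa [halfPlane, polar, this] using hr

theorem angle_polar (r : ℝ) : angle φ (polar r φ) = φ := by
  have : Real.cos φ * (r * Real.sin φ) - Real.sin φ * (r * Real.cos φ) = 0 := by ring
  simp [angle, polar, this]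

theorem norm_polar {r : ℝ} (hr : 0 ≤ r) (θ : ℝ) : ‖polar r θ‖ = r := by
  rw [EuclideanSpace.norm_eq, Fin.sum_univ_two, Real.norm_eq_abs, Real.norm_eq_abs, sq_abs, sq_abs]
  have : (r * Real.cos θ) ^ 2 + (r * Real.sin θ) ^ 2 = r ^ 2 := by
    linear_combination r ^ 2 * Real.sin_sq_add_cos_sq θ
  simp [polar, this, Real.sqrt_sq hr]

theorem continuous_polar : Continuous fun p : ℝ × ℝ => polar p.1 p.2 := by
  unfold polar
  refine (PiLp.continuous_toLp 2 _).comp (continuous_pi fun i => ?_)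
  fin_cases i <;> simp <;> fun_prop

end Angle

/-! ### The strict supersolution. -/

section Barrier

theorem abs_mul_le_mul_of_abs_le {a b s t : ℝ} (ha : |a| ≤ s) (hb : |b| ≤ t) :
    |a * b| ≤ s * t := by
  rw [abs_mul]
  exact mul_le_mul ha hb (abs_nonneg _) ((abs_nonneg _).trans ha)

theorem abs_add_le_add_of_abs_le {a b s t : ℝ} (ha : |a| ≤ s) (hb : |b| ≤ t) :
    |a + b| ≤ s + t :=
  (abs_add_le a b).trans (add_le_add ha hb)

theorem abs_two_mul_le_add_sq (a b : ℝ) : |2 * a * b| ≤ a ^ 2 + b ^ 2 := by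
  rw [abs_le]
  constructor <;> nlinarith [sq_nonneg (a + b), sq_nonneg (a - b)]

theorem abs_sub_sq_le_add_sq (a b : ℝ) : |b ^ 2 - a ^ 2| ≤ a ^ 2 + b ^ 2 := by
  rw [abs_le]
  constructor <;> nlinarith [sq_nonneg a, sq_nonneg b]

/-- The diagonal entries are positive with sum at most M₁; testing with (1, ±1) bounds 2|a₀₁| by the
trace. -/
theorem IsElliptic.abs_entry_le {Ω : Set Plane} {A : Plane → Matrix (Fin 2) (Fin 2) ℝ}
    {c₀ M₁ : ℝ} (hA : IsElliptic Ω A c₀ M₁) (hc₀ : 0 < c₀) {x : Plane} (hx : x ∈ Ω)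
    (i j : Fin 2) : |A x i j| ≤ M₁ := by
  have hs : A x 1 0 = A x 0 1 := by simpa using congrFun (congrFun (hA.symm x hx) 0) 1
  have ht := hA.trace_le x hx
  have e0 := hA.lower x hx !₂[1, 0]
  have e1 := hA.lower x hx !₂[0, 1]
  have e2 := hA.lower x hx !₂[1, 1]
  have e3 := hA.lower x hx !₂[1, -1]
  simp only [Fin.sum_univ_two, EuclideanSpace.norm_sq_eq, Matrix.trace, hs] at e0 e1 e2 e3 ht
  simp at e0 e1 e2 e3 ht
  rw [abs_le]
  fin_cases i <;> fin_cases j <;> simp [hs] <;> constructor <;> linarith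

/-- The radial factor of the barrier, which depends on the first coordinate only. -/
noncomputable def weight (B l : ℝ) (x : Plane) : ℝ := B - Real.exp (l * x 0)

variable {B l : ℝ} {x : Plane}

theorem contDiff_weight {n : WithTop ℕ∞} : ContDiff ℝ n (weight B l) :=
  contDiff_const.sub (Real.contDiff_exp.comp (contDiff_const.mul (contDiff_coord 0)))

theorem hasDerivAt_exp_const_mul (c l t : ℝ) :
    HasDerivAt (fun s => c * Real.exp (l * s)) (c * l * Real.exp (l * t)) t := by
  have := (((hasDerivAt_id t).const_mul l).exp).const_mul c
  simp only [id, mul_one] at this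
  exact this.congr_deriv (by ring)

theorem weight_eq : weight B l = fun x => B - 1 * Real.exp (l * x 0) := by
  funext x
  simp [weight]

theorem pderiv_weight (i : Fin 2) :
    pderiv i (weight B l) x = -(l * Real.exp (l * x 0)) * if 0 = i then 1 else 0 := by
  have h := (hasDerivAt_exp_const_mul 1 l (x 0)).const_sub B
  rw [weight_eq, pderiv_comp (h := fun t => B - 1 * Real.exp (l * t)) i h
    (differentiableAt_coord 0), pderiv_coord]
  simp

theorem pderiv_pderiv_weight (i j : Fin 2) :
    pderiv i (pderiv j (weight B l)) x =
      -(l ^ 2 * Real.exp (l * x 0)) * (if 0 = i then 1 else 0) * if 0 = j then 1 else 0 := by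
  have h1 (t : ℝ) := (hasDerivAt_exp_const_mul 1 l t).const_sub B
  have h2 (t : ℝ) := (hasDerivAt_exp_const_mul (1 * l) l t).neg
  have h0 : pderiv i (pderiv 0 fun y : Plane => y 0) x = 0 := by
    have : (pderiv 0 fun y : Plane => y 0) = fun _ => 1 := by
      funext y
      simp [pderiv_coord]
    rw [this, pderiv_const]
  have h0' : pderiv i (pderiv 1 fun y : Plane => y 0) x = 0 := by
    have : (pderiv 1 fun y : Plane => y 0) = fun _ => 0 := by
      funext y
      simp [pderiv_coord]
    rw [this, pderiv_const]
  rw [weight_eq, pderiv_pderiv_comp (h := fun t => B - 1 * Real.exp (l * t)) i j h1 h2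
    (contDiff_coord 0).contDiffAt, pderiv_coord, pderiv_coord]
  fin_cases j
  · simp [h0]
    ring_nf
  · simp [h0']

/-- The zeroth-order algebra behind the positivity of `L` applied to the barrier. -/
theorem barrier_estimate {a₀₀ a₀₁ a₁₁ b₀ b₁ T₀ T₁ T₀₀ T₀₁ T₁₁ H H₁ H₂ g e M₁ M₂ τ B E κ ν l : ℝ}
    (hH : 0 < H) (ha₀₀ : |a₀₀| ≤ M₁) (ha₀₁ : |a₀₁| ≤ M₁) (ha₁₁ : |a₁₁| ≤ M₁)
    (hb₀ : |b₀| ≤ M₂) (hb₁ : |b₁| ≤ M₂) (hT₀ : |T₀| ≤ τ) (hT₁ : |T₁| ≤ τ)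
    (hT₀₀ : |T₀₀| ≤ τ ^ 2) (hT₀₁ : |T₀₁| ≤ τ ^ 2) (hT₁₁ : |T₁₁| ≤ τ ^ 2)
    (hH₁ : |H₁| ≤ ν * H) (hH₂ : |H₂| ≤ ν * H) (hg : |g| ≤ B) (he : |e| ≤ E) (hl : 0 ≤ l)
    (hκ : κ ≤ l ^ 2 * e * a₀₀ - l * e * b₀)
    (hν : ν * (8 * B * M₁ * τ ^ 2 + 4 * l * E * M₁ * τ + 2 * B * M₂ * τ) < κ) :
    0 < H * (l ^ 2 * e * a₀₀ - l * e * b₀)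
      - H₂ * g * (a₀₀ * (T₀ * T₀) + a₀₁ * (T₀ * T₁) + a₀₁ * (T₁ * T₀) + a₁₁ * (T₁ * T₁))
      - H₁ * g * (a₀₀ * T₀₀ + a₀₁ * T₀₁ + a₀₁ * T₀₁ + a₁₁ * T₁₁)
      + 2 * l * (H₁ * e * (a₀₀ * T₀ + a₀₁ * T₁)) + H₁ * g * (b₀ * T₀ + b₁ * T₁) := by
  have m {a b s t : ℝ} (ha : |a| ≤ s) (hb : |b| ≤ t) := abs_mul_le_mul_of_abs_le ha hb
  have p {a b s t : ℝ} (ha : |a| ≤ s) (hb : |b| ≤ t) := abs_add_le_add_of_abs_le ha hb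
  -- The h'' and h' terms cost at most 4BM₁τ² each, the cross term 4lEM₁τ and the drift 2BM₂τ, all
  -- times νH; together these are the left side of `hν`.
  have k1 := (abs_le.1 (m (m hH₂ hg) (p (p (p (m ha₀₀ (m hT₀ hT₀)) (m ha₀₁ (m hT₀ hT₁)))
    (m ha₀₁ (m hT₁ hT₀))) (m ha₁₁ (m hT₁ hT₁))))).2
  have k2 := (abs_le.1 (m (m hH₁ hg) (p (p (p (m ha₀₀ hT₀₀) (m ha₀₁ hT₀₁)) (m ha₀₁ hT₀₁))
    (m ha₁₁ hT₁₁)))).2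
  have k3 := mul_le_mul_of_nonneg_left
    (abs_le.1 (m (m hH₁ he) (p (m ha₀₀ hT₀) (m ha₀₁ hT₁)))).1 (by positivity : 0 ≤ 2 * l)
  have k4 := (abs_le.1 (m (m hH₁ hg) (p (m hb₀ hT₀) (m hb₁ hT₁)))).1
  have k5 := mul_le_mul_of_nonneg_left hκ hH.le
  have k6 := mul_lt_mul_of_pos_left hν hH
  linarith

/-- Leibniz rule L(pw) = p L w + w L p - 2 A∇p·∇w with p = h ∘ f. The constant m drops out because L
has no zeroth-order term; the cross term is added because ∂₀w = -l exp(l x₀). -/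
theorem opL_barrier_eq {A : Plane → Matrix (Fin 2) (Fin 2) ℝ} {b : Plane → Plane} {m : ℝ}
    {f : Plane → ℝ} {h h' h'' : ℝ → ℝ} (hf : ContDiffAt ℝ 2 f x) (hcd : ContDiff ℝ 2 h)
    (h1 : ∀ t, HasDerivAt h (h' t) t) (h2 : ∀ t, HasDerivAt h' (h'' t) t)
    (hs : A x 1 0 = A x 0 1) (hsf : pderiv 1 (pderiv 0 f) x = pderiv 0 (pderiv 1 f) x) :
    opL A b (fun y => m + h (f y) * weight B l y) x =
      h (f x) * (l ^ 2 * Real.exp (l * x 0) * A x 0 0 - l * Real.exp (l * x 0) * b x 0)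
      - h'' (f x) * weight B l x * (A x 0 0 * (pderiv 0 f x * pderiv 0 f x) +
          A x 0 1 * (pderiv 0 f x * pderiv 1 f x) + A x 0 1 * (pderiv 1 f x * pderiv 0 f x) +
          A x 1 1 * (pderiv 1 f x * pderiv 1 f x))
      - h' (f x) * weight B l x * (A x 0 0 * pderiv 0 (pderiv 0 f) x +
          A x 0 1 * pderiv 0 (pderiv 1 f) x + A x 0 1 * pderiv 0 (pderiv 1 f) x +
          A x 1 1 * pderiv 1 (pderiv 1 f) x)
      + 2 * l * (h' (f x) * Real.exp (l * x 0) * (A x 0 0 * pderiv 0 f x + A x 0 1 * pderiv 1 f x))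
      + h' (f x) * weight B l x * (b x 0 * pderiv 0 f x + b x 1 * pderiv 1 f x) := by
  have hp : ContDiffAt ℝ 2 (fun y => h (f y)) x := hcd.contDiffAt.comp x hf
  have hw : ContDiffAt ℝ 2 (weight B l) x := contDiff_weight.contDiffAt
  have hm : ContDiffAt ℝ 2 (fun _ : Plane => m) x := contDiffAt_const
  have hpm : ContDiffAt ℝ 2 (fun y => h (f y) * weight B l y) x := hp.mul hw
  have hc (i j : Fin 2) : pderiv i (pderiv j fun _ : Plane => m) x = 0 := by
    have : (pderiv j fun _ : Plane => m) = fun _ => 0 := funext fun y => pderiv_const j m y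
    rw [this, pderiv_const]
  have hfd := hf.differentiableAt (by simp)
  have hpd := hp.differentiableAt (by simp)
  have hwd := hw.differentiableAt (by simp)
  have grad (i : Fin 2) : pderiv i (fun y => m + h (f y) * weight B l y) x =
      h (f x) * pderiv i (weight B l) x + weight B l x * (h' (f x) * pderiv i f x) := by
    rw [pderiv_add i (hm.differentiableAt (by simp)) (hpm.differentiableAt (by simp)),
      pderiv_const, pderiv_mul i hpd hwd, pderiv_comp i (h1 _) hfd, zero_add]
  have hess (i j : Fin 2) : pderiv i (pderiv j fun y => m + h (f y) * weight B l y) x =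
      h (f x) * pderiv i (pderiv j (weight B l)) x +
        h' (f x) * pderiv i f x * pderiv j (weight B l) x +
        h' (f x) * pderiv j f x * pderiv i (weight B l) x +
        weight B l x * (h'' (f x) * pderiv i f x * pderiv j f x +
          h' (f x) * pderiv i (pderiv j f) x) := by
    rw [pderiv_pderiv_add i j hm hpm, hc, pderiv_pderiv_mul i j hp hw, zero_add,
      pderiv_pderiv_comp i j h1 h2 hf, pderiv_comp i (h1 _) hfd, pderiv_comp j (h1 _) hfd]
  simp only [opL, Fin.sum_univ_two, grad, hess, pderiv_weight, pderiv_pderiv_weight, hs, hsf,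
    ↓reduceIte, zero_ne_one]
  ring

/-- The barrier `m + h(angle) * weight` is a strict supersolution. -/
theorem opL_barrier_pos {φ m c₀ M₁ M₂ τ R ν : ℝ} {h h' h'' : ℝ → ℝ} {Ω : Set Plane}
    {A : Plane → Matrix (Fin 2) (Fin 2) ℝ} {b : Plane → Plane} (hc₀ : 0 < c₀)
    (hA : IsElliptic Ω A c₀ M₁) (hxΩ : x ∈ Ω) (hb : ‖b x‖ ≤ M₂) (hx : x ∈ halfPlane φ)
    (hτ : 0 < τ) (hxτ : τ⁻¹ ≤ ‖x‖) (hxR : ‖x‖ ≤ R) (hl : 0 < l) (hlc : M₂ + 1 ≤ c₀ * l)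
    (hB : B = 1 + Real.exp (l * R))
    (h1 : ∀ t, HasDerivAt h (h' t) t) (h2 : ∀ t, HasDerivAt h' (h'' t) t)
    (hpos : ∀ t, 0 < h t) (hh1 : ∀ t, |h' t| ≤ ν * h t) (hh2 : ∀ t, |h'' t| ≤ ν * h t)
    (hν : ν * (8 * B * M₁ * τ ^ 2 + 4 * l * Real.exp (l * R) * M₁ * τ + 2 * B * M₂ * τ) <
      l * Real.exp (-(l * R))) (hcd : ContDiff ℝ 2 h) :
    0 < opL A b (fun y => m + h (angle φ y) * weight B l y) x := by
  have hs : A x 1 0 = A x 0 1 := by simpa using congrFun (congrFun (hA.symm x hxΩ) 0) 1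
  have hnorm : ‖x‖ ^ 2 = x 0 ^ 2 + x 1 ^ 2 := by
    simp [EuclideanSpace.norm_sq_eq, Fin.sum_univ_two]
  have hρ : 0 < ‖x‖ := (inv_pos.2 hτ).trans_le hxτ
  have hinv : ‖x‖⁻¹ ≤ τ := inv_le_of_inv_le₀ hτ hxτ
  have hcoord (y : Plane) (i : Fin 2) : |y i| ≤ ‖y‖ := by
    simpa using PiLp.norm_apply_le y i
  have hdiv {s : ℝ} (hs : |s| ≤ ‖x‖) : |s / (x 0 ^ 2 + x 1 ^ 2)| ≤ τ := by
    rw [← hnorm, abs_div, abs_of_pos (pow_pos hρ 2)]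
    refine le_trans ?_ hinv
    rw [div_le_iff₀ (pow_pos hρ 2)]
    calc |s| ≤ ‖x‖ := hs
      _ = ‖x‖⁻¹ * ‖x‖ ^ 2 := by field_simp
  have hdiv2 {s : ℝ} (hs : |s| ≤ ‖x‖ ^ 2) : |s / (x 0 ^ 2 + x 1 ^ 2) ^ 2| ≤ τ ^ 2 := by
    rw [← hnorm, abs_div, abs_of_pos (pow_pos (pow_pos hρ 2) 2)]
    refine le_trans ?_ (pow_le_pow_left₀ (inv_nonneg.2 hρ.le) hinv 2)
    rw [div_le_iff₀ (pow_pos (pow_pos hρ 2) 2)]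
    calc |s| ≤ ‖x‖ ^ 2 := hs
      _ = ‖x‖⁻¹ ^ 2 * (‖x‖ ^ 2) ^ 2 := by field_simp
  have hx0 := abs_le.1 ((hcoord x 0).trans hxR)
  have hE : Real.exp (l * x 0) ≤ Real.exp (l * R) :=
    Real.exp_le_exp.2 (mul_le_mul_of_nonneg_left hx0.2 hl.le)
  have hE' : Real.exp (-(l * R)) ≤ Real.exp (l * x 0) :=
    Real.exp_le_exp.2 (by linarith [mul_le_mul_of_nonneg_left hx0.1 hl.le])
  have hep := Real.exp_pos (l * x 0)
  have ha0 : c₀ ≤ A x 0 0 := by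
    have := hA.lower x hxΩ !₂[1, 0]
    simpa [Fin.sum_univ_two, EuclideanSpace.norm_sq_eq] using this
  obtain ⟨p0, p1⟩ := pderiv_angle hx
  obtain ⟨q0, q1, q2, q3⟩ := pderiv_pderiv_angle hx
  have bx (i : Fin 2) : |b x i| ≤ M₂ := (hcoord _ i).trans hb
  have aa (i j : Fin 2) := hA.abs_entry_le hc₀ hxΩ i j
  have hT0 : |pderiv 0 (angle φ) x| ≤ τ := by
    rw [p0]
    exact hdiv (by rw [abs_neg]; exact hcoord x 1)
  have hT1 : |pderiv 1 (angle φ) x| ≤ τ := by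
    rw [p1]
    exact hdiv (hcoord x 0)
  have hT00 : |pderiv 0 (pderiv 0 (angle φ)) x| ≤ τ ^ 2 := by
    rw [q0]
    refine hdiv2 ?_
    rw [hnorm]
    exact abs_two_mul_le_add_sq _ _
  have hT01 : |pderiv 0 (pderiv 1 (angle φ)) x| ≤ τ ^ 2 := by
    rw [q1]
    refine hdiv2 ?_
    rw [hnorm]
    exact abs_sub_sq_le_add_sq _ _
  have hT11 : |pderiv 1 (pderiv 1 (angle φ)) x| ≤ τ ^ 2 := by
    rw [q3]
    refine hdiv2 ?_
    rw [hnorm, abs_neg]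
    exact abs_two_mul_le_add_sq _ _
  have q12 : pderiv 1 (pderiv 0 (angle φ)) x = pderiv 0 (pderiv 1 (angle φ)) x := q2.trans q1.symm
  have hg : |weight B l x| ≤ B := by
    rw [weight, abs_le]
    constructor <;> linarith
  -- Lower bound for L w, the margin that pays for every term containing a derivative of the angle.
  have hκ : l * Real.exp (-(l * R)) ≤
      l ^ 2 * Real.exp (l * x 0) * A x 0 0 - l * Real.exp (l * x 0) * b x 0 := by
    have hb0 := (abs_le.1 (bx 0)).2
    have h3 : 1 ≤ l * A x 0 0 - b x 0 := by
      have := mul_le_mul_of_nonneg_left ha0 hl.le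
      linarith
    calc l * Real.exp (-(l * R)) ≤ l * Real.exp (l * x 0) := mul_le_mul_of_nonneg_left hE' hl.le
      _ ≤ l * Real.exp (l * x 0) * (l * A x 0 0 - b x 0) :=
        le_mul_of_one_le_right (by positivity) h3
      _ = _ := by ring
  have key := barrier_estimate (hpos (angle φ x)) (aa 0 0) (aa 0 1) (aa 1 1) (bx 0) (bx 1) hT0 hT1
    hT00 hT01 hT11 (hh1 (angle φ x)) (hh2 (angle φ x)) hg
    (by rw [abs_of_pos hep]; exact hE) hl.le hκ hν
  rw [opL_barrier_eq (contDiffAt_angle hx) hcd h1 h2 hs q12]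
  exact key

end Barrier

/-! ### Comparison on truncated strips and the Phragmén–Lindelöf estimate. -/

section Comparison

/-- The parameters of a barrier adapted to the ellipticity constants and to the annulus
`rstar ≤ |x| ≤ R` containing the spiral. -/
structure BarrierRate (c₀ M₁ M₂ rstar R l B ν : ℝ) : Prop where
  l_pos : 0 < l
  drift_le : M₂ + 1 ≤ c₀ * l
  B_eq : B = 1 + Real.exp (l * R)
  rate_pos : 0 < ν
  rate_le_one : ν ≤ 1
  rate_lt : ν * (8 * B * M₁ * rstar⁻¹ ^ 2 + 4 * l * Real.exp (l * R) * M₁ * rstar⁻¹ +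
    2 * B * M₂ * rstar⁻¹) < l * Real.exp (-(l * R))

/-- Neither Q nor κ involves ν, so the last condition only asks that ν be small; κ / (Q + κ + 1) is
small enough and is also at most 1. -/
theorem exists_barrierRate {c₀ M₁ M₂ rstar : ℝ} (R : ℝ) (hc₀ : 0 < c₀) (hM₁ : 0 < M₁)
    (hM₂ : 0 ≤ M₂) (hr : 0 < rstar) : ∃ l B ν, BarrierRate c₀ M₁ M₂ rstar R l B ν := by
  set l := (M₂ + 1) / c₀ with hl
  set B := 1 + Real.exp (l * R) with hB
  have hlpos : 0 < l := by positivity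
  have hBpos : 0 < B := by positivity
  set Q := 8 * B * M₁ * rstar⁻¹ ^ 2 + 4 * l * Real.exp (l * R) * M₁ * rstar⁻¹ +
    2 * B * M₂ * rstar⁻¹ with hQ
  set κ := l * Real.exp (-(l * R)) with hκ
  have hQpos : 0 ≤ Q := by positivity
  have hκpos : 0 < κ := by positivity
  have hd : 0 < Q + κ + 1 := by positivity
  refine ⟨l, B, κ / (Q + κ + 1), hlpos, ?_, rfl, by positivity, ?_, ?_⟩
  · rw [hl]
    field_simp
    rfl
  · rw [div_le_one hd]
    linarith
  · rw [← hQ, div_mul_eq_mul_div, div_lt_iff₀ hd]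
    nlinarith [mul_pos hκpos hκpos]

/-- Admissible data of the problem. -/
structure IsSpiralData (c₀ M₁ M₂ rstar R θ₀ : ℝ) (r₁ r₂ : ℝ → ℝ)
    (A : Plane → Matrix (Fin 2) (Fin 2) ℝ) (b : Plane → Plane) (u : Plane → ℝ) : Prop where
  c₀_pos : 0 < c₀
  spiral : IsSpiral θ₀ r₁ r₂ rstar
  r₂_le : ∀ θ, θ₀ ≤ θ → r₂ θ ≤ R
  elliptic : IsElliptic (domU θ₀ r₁ r₂) A c₀ M₁
  drift_le : ∀ x ∈ domU θ₀ r₁ r₂, ‖b x‖ ≤ M₂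
  contDiffOn : ContDiffOn ℝ 2 u (domU θ₀ r₁ r₂)
  continuousOn : ContinuousOn u (domUtilde θ₀ r₁ r₂)
  growth : BelowExpGrowth r₁ r₂ u

theorem domU_mono {θ₀ θ₁ : ℝ} (h : θ₀ ≤ θ₁) (r₁ r₂ : ℝ → ℝ) :
    domU θ₁ r₁ r₂ ⊆ domU θ₀ r₁ r₂ := by
  rintro x ⟨r, θ, h1, h2⟩
  exact ⟨r, θ, h.trans_lt h1, h2⟩

theorem domUtilde_mono {θ₀ θ₁ : ℝ} (h : θ₀ ≤ θ₁) (r₁ r₂ : ℝ → ℝ) :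
    domUtilde θ₁ r₁ r₂ ⊆ domUtilde θ₀ r₁ r₂ := by
  rintro x ⟨r, θ, h1, h2⟩
  exact ⟨r, θ, h.trans h1, h2⟩

variable {c₀ M₁ M₂ rstar R θ₀ l B ν : ℝ} {r₁ r₂ : ℝ → ℝ}
  {A : Plane → Matrix (Fin 2) (Fin 2) ℝ} {b : Plane → Plane} {u : Plane → ℝ}

/-- Allows a restart at a later angle with the same constants, as the limsup bound requires. -/
theorem IsSpiralData.mono (hd : IsSpiralData c₀ M₁ M₂ rstar R θ₀ r₁ r₂ A b u) {θ₁ : ℝ}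
    (h : θ₀ ≤ θ₁) : IsSpiralData c₀ M₁ M₂ rstar R θ₁ r₁ r₂ A b u where
  c₀_pos := hd.c₀_pos
  spiral :=
    { continuousOn_r₁ := hd.spiral.continuousOn_r₁.mono (Set.Ici_subset_Ici.2 h)
      continuousOn_r₂ := hd.spiral.continuousOn_r₂.mono (Set.Ici_subset_Ici.2 h)
      r₁_pos := fun θ hθ => hd.spiral.r₁_pos θ (h.trans hθ)
      r₂_pos := fun θ hθ => hd.spiral.r₂_pos θ (h.trans hθ)
      r₂_shift_lt := fun θ hθ => hd.spiral.r₂_shift_lt θ (h.trans hθ)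
      r₁_lt_r₂ := fun θ hθ => hd.spiral.r₁_lt_r₂ θ (h.trans hθ)
      rstar_pos := hd.spiral.rstar_pos
      tendsto_r₁ := hd.spiral.tendsto_r₁
      tendsto_r₂ := hd.spiral.tendsto_r₂ }
  r₂_le := fun θ hθ => hd.r₂_le θ (h.trans hθ)
  elliptic :=
    { symm := fun x hx => hd.elliptic.symm x (domU_mono h _ _ hx)
      lower := fun x hx => hd.elliptic.lower x (domU_mono h _ _ hx)
      trace_le := fun x hx => hd.elliptic.trace_le x (domU_mono h _ _ hx) }
  drift_le := fun x hx => hd.drift_le x (domU_mono h _ _ hx)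
  contDiffOn := hd.contDiffOn.mono (domU_mono h _ _)
  continuousOn := hd.continuousOn.mono (domUtilde_mono h _ _)
  growth := hd.growth

/-- Along θ + 2πn the chain r₁ < r₂ < r₁ of the previous turn makes r₁ decrease, and its limit is
r⋆. -/
theorem IsSpiral.rstar_le_r₁ (h : IsSpiral θ₀ r₁ r₂ rstar) {θ : ℝ} (hθ : θ₀ ≤ θ) :
    rstar ≤ r₁ θ := by
  have hge (n : ℕ) : θ₀ ≤ θ + n * (2 * Real.pi) :=
    hθ.trans (le_add_of_nonneg_right (by positivity))
  have hanti : Antitone fun n : ℕ => r₁ (θ + n * (2 * Real.pi)) := by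
    refine antitone_nat_of_succ_le fun n => ?_
    have h1 := h.r₁_lt_r₂ _ (hge (n + 1))
    have h2 := h.r₂_shift_lt _ (hge n)
    have e : θ + ((n + 1 : ℕ) : ℝ) * (2 * Real.pi) = θ + n * (2 * Real.pi) + 2 * Real.pi := by
      push_cast
      ring
    rw [e] at h1 ⊢
    exact (h1.trans h2).le
  have hlim : Filter.Tendsto (fun n : ℕ => r₁ (θ + n * (2 * Real.pi))) Filter.atTop (𝓝 rstar) :=
    h.tendsto_r₁.comp <| Filter.tendsto_atTop_add_const_left _ _ <|
      tendsto_natCast_atTop_atTop.atTop_mul_const (by positivity)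
  simpa using hanti.le_of_tendsto hlim 0

/-- The lower bound 1 lets the factor be dropped on the boundary; the upper bound B becomes the
constant in the final estimate. -/
theorem weight_bounds {x : Plane} (hl : 0 < l) (hB : B = 1 + Real.exp (l * R)) (hx : ‖x‖ ≤ R) :
    1 ≤ weight B l x ∧ weight B l x ≤ B := by
  have h0 : x 0 ≤ R := (le_abs_self _).trans (hx.trans' (by simpa using PiLp.norm_apply_le x 0))
  have h1 : Real.exp (l * x 0) ≤ Real.exp (l * R) :=
    Real.exp_le_exp.2 (mul_le_mul_of_nonneg_left h0 hl.le)
  have h2 := Real.exp_pos (l * x 0)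
  constructor <;> simp only [weight] <;> linarith

/-- The closed strip in polar coordinates, truncated at the angle `T`, is compact. -/
theorem IsSpiral.isCompact_strip (h : IsSpiral θ₀ r₁ r₂ rstar) (T : ℝ) :
    IsCompact {p : ℝ × ℝ | (θ₀ ≤ p.2 ∧ p.2 ≤ T) ∧ r₁ p.2 ≤ p.1 ∧ p.1 ≤ r₂ p.2} := by
  -- The strip is the image of a rectangle under linear interpolation between r₁ and r₂.
  have hK : IsCompact (Set.Icc (0 : ℝ) 1 ×ˢ Set.Icc θ₀ T) := isCompact_Icc.prod isCompact_Icc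
  have hmaps : Set.MapsTo (Prod.snd : ℝ × ℝ → ℝ) (Set.Icc (0 : ℝ) 1 ×ˢ Set.Icc θ₀ T)
      (Set.Ici θ₀) := fun p hp => hp.2.1
  have c1 := h.continuousOn_r₁.comp continuousOn_snd hmaps
  have c2 := h.continuousOn_r₂.comp continuousOn_snd hmaps
  have hcont : ContinuousOn
      (fun p : ℝ × ℝ => (r₁ p.2 + p.1 * (r₂ p.2 - r₁ p.2), p.2))
      (Set.Icc (0 : ℝ) 1 ×ˢ Set.Icc θ₀ T) :=
    (c1.add (continuousOn_fst.mul (c2.sub c1))).prodMk continuousOn_snd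
  convert hK.image_of_continuousOn hcont using 1
  ext ⟨r, θ⟩
  constructor
  · rintro ⟨⟨h1, h2⟩, h3, h4⟩
    have hpos := sub_pos.2 (h.r₁_lt_r₂ θ h1)
    simp only at h3 h4
    refine ⟨((r - r₁ θ) / (r₂ θ - r₁ θ), θ), ⟨⟨?_, ?_⟩, h1, h2⟩, ?_⟩
    · exact div_nonneg (sub_nonneg.2 h3) hpos.le
    · rw [div_le_one hpos]
      linarith
    · simp [hpos.ne']
  · rintro ⟨⟨s, t⟩, ⟨⟨h1, h2⟩, h3, h4⟩, he⟩
    simp only [Prod.mk.injEq] at he h1 h2 h3 h4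
    obtain ⟨rfl, rfl⟩ := he
    have hpos := sub_pos.2 (h.r₁_lt_r₂ t h3)
    refine ⟨⟨h3, h4⟩, ?_, ?_⟩ <;> simp only <;> nlinarith

/-- The angle and the radius of points near an interior point stay in the open strip. -/
theorem IsSpiral.eventually_mem_strip (h : IsSpiral θ₀ r₁ r₂ rstar) {ρ φ T : ℝ} (h0 : θ₀ < φ)
    (hT : φ < T) (h1 : r₁ φ < ρ) (h2 : ρ < r₂ φ) :
    ∀ᶠ y in 𝓝 (polar ρ φ), polar ‖y‖ (angle φ y) = y ∧ θ₀ < angle φ y ∧ angle φ y < T ∧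
      r₁ (angle φ y) < ‖y‖ ∧ ‖y‖ < r₂ (angle φ y) := by
  have hρ : 0 < ρ := (h.r₁_pos φ h0.le).trans h1
  have hx : polar ρ φ ∈ halfPlane φ := polar_mem_halfPlane hρ
  have ha : Filter.Tendsto (angle φ) (𝓝 (polar ρ φ)) (𝓝 φ) := by
    have := (contDiffAt_angle (n := 0) hx).continuousAt.tendsto
    rwa [angle_polar] at this
  have hn : Filter.Tendsto (fun y : Plane => ‖y‖) (𝓝 (polar ρ φ)) (𝓝 ρ) := by
    have := (continuous_norm (E := Plane)).tendsto (polar ρ φ)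
    rwa [norm_polar hρ.le] at this
  have c1 := (h.continuousOn_r₁.continuousAt (Ici_mem_nhds h0)).tendsto.comp ha
  have c2 := (h.continuousOn_r₂.continuousAt (Ici_mem_nhds h0)).tendsto.comp ha
  filter_upwards [(isOpen_halfPlane φ).eventually_mem hx, ha.eventually_const_lt h0,
    ha.eventually_lt_const hT, c1.eventually_lt hn h1, hn.eventually_lt c2 h2] with y y1 y2 y3 y4 y5
  exact ⟨polar_angle y1, y2, y3, y4, y5⟩

/-- Comparison of a subsolution with the barrier on a truncated strip. -/
theorem IsSpiralData.le_barrier (hd : IsSpiralData c₀ M₁ M₂ rstar R θ₀ r₁ r₂ A b u)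
    (hB : BarrierRate c₀ M₁ M₂ rstar R l B ν)
    (hu : ∀ x ∈ domU θ₀ r₁ r₂, opL A b u x ≤ 0) {m T : ℝ} {h h' h'' : ℝ → ℝ}
    (h1 : ∀ t, HasDerivAt h (h' t) t) (h2 : ∀ t, HasDerivAt h' (h'' t) t)
    (hcd : ContDiff ℝ 2 h) (hpos : ∀ t, 0 < h t) (hh1 : ∀ t, |h' t| ≤ ν * h t)
    (hh2 : ∀ t, |h'' t| ≤ ν * h t)
    (hbd : ∀ r θ, θ₀ ≤ θ → θ ≤ T → r₁ θ ≤ r → r ≤ r₂ θ →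
      (θ = θ₀ ∨ θ = T ∨ r = r₁ θ ∨ r = r₂ θ) →
      u (polar r θ) ≤ m + h θ * weight B l (polar r θ)) {r θ : ℝ} (hθ : θ₀ ≤ θ) (hθT : θ ≤ T)
    (hr1 : r₁ θ ≤ r) (hr2 : r ≤ r₂ θ) :
    u (polar r θ) ≤ m + h θ * weight B l (polar r θ) := by
  set K := {p : ℝ × ℝ | (θ₀ ≤ p.2 ∧ p.2 ≤ T) ∧ r₁ p.2 ≤ p.1 ∧ p.1 ≤ r₂ p.2} with hK
  have hcu : ContinuousOn (fun p : ℝ × ℝ => u (polar p.1 p.2)) K :=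
    hd.continuousOn.comp continuous_polar.continuousOn
      fun p hp => ⟨p.1, p.2, hp.1.1, hp.2.1, hp.2.2, rfl⟩
  have hcw : Continuous fun p : ℝ × ℝ => m + h p.2 * weight B l (polar p.1 p.2) :=
    continuous_const.add ((hcd.continuous.comp continuous_snd).mul
      ((contDiff_weight (n := 0)).continuous.comp continuous_polar))
  obtain ⟨⟨ρ, φ⟩, ⟨⟨hφ0, hφT⟩, hρ1, hρ2⟩, hmax⟩ :=
    (hd.spiral.isCompact_strip T).exists_isMaxOn ⟨(r, θ), ⟨hθ, hθT⟩, hr1, hr2⟩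
      (hcu.sub hcw.continuousOn)
  simp only at hφ0 hφT hρ1 hρ2
  have hle {r θ : ℝ} (a1 : θ₀ ≤ θ) (a2 : θ ≤ T) (a3 : r₁ θ ≤ r) (a4 : r ≤ r₂ θ) :
      u (polar r θ) - (m + h θ * weight B l (polar r θ)) ≤
        u (polar ρ φ) - (m + h φ * weight B l (polar ρ φ)) :=
    hmax (show (r, θ) ∈ K from ⟨⟨a1, a2⟩, a3, a4⟩)
  suffices u (polar ρ φ) ≤ m + h φ * weight B l (polar ρ φ) by
    have := hle hθ hθT hr1 hr2
    linarith
  by_cases hcase : φ = θ₀ ∨ φ = T ∨ ρ = r₁ φ ∨ ρ = r₂ φ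
  · exact hbd ρ φ hφ0 hφT hρ1 hρ2 hcase
  exfalso
  simp only [not_or] at hcase
  obtain ⟨n1, n2, n3, n4⟩ := hcase
  have hev := hd.spiral.eventually_mem_strip (lt_of_le_of_ne hφ0 (Ne.symm n1))
    (lt_of_le_of_ne hφT n2) (lt_of_le_of_ne hρ1 (Ne.symm n3)) (lt_of_le_of_ne hρ2 n4)
  have hρ : 0 < ρ := (hd.spiral.r₁_pos φ hφ0).trans_le hρ1
  have hUn : ∀ᶠ y in 𝓝 (polar ρ φ), y ∈ domU θ₀ r₁ r₂ :=
    hev.mono fun y hy => ⟨‖y‖, angle φ y, hy.2.1, hy.2.2.2.1, hy.2.2.2.2, hy.1.symm⟩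
  have hU := hUn.self_of_nhds
  have hx : polar ρ φ ∈ halfPlane φ := polar_mem_halfPlane hρ
  have hud : ContDiffAt ℝ 2 u (polar ρ φ) := hd.contDiffOn.contDiffAt hUn
  have hwd : ContDiffAt ℝ 2 (fun y => m + h (angle φ y) * weight B l y) (polar ρ φ) :=
    contDiffAt_const.add ((hcd.contDiffAt.comp _ (contDiffAt_angle hx)).mul
      contDiff_weight.contDiffAt)
  -- Nearby points y have polar coordinates (‖y‖, `angle φ y`) inside the strip, so the maximum over
  -- parameters is a local maximum in the plane.
  have hloc : IsLocalMax (fun y => u y - (m + h (angle φ y) * weight B l y)) (polar ρ φ) := by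
    filter_upwards [hev] with y hy
    have := hle hy.2.1.le hy.2.2.1.le hy.2.2.2.1.le hy.2.2.2.2.le
    rw [hy.1] at this
    simpa only [angle_polar] using this
  have hnn := opL_nonneg_of_isLocalMax b hd.c₀_pos (hd.elliptic.symm _ hU)
    (hd.elliptic.lower _ hU) (hud.sub hwd) hloc
  have hrs := hd.spiral.rstar_le_r₁ hφ0
  have hbar := opL_barrier_pos (m := m) hd.c₀_pos hd.elliptic hU (hd.drift_le _ hU) hx
    (inv_pos.2 hd.spiral.rstar_pos) (by rw [inv_inv, norm_polar hρ.le]; exact hrs.trans hρ1)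
    (by rw [norm_polar hρ.le]; exact hρ2.trans (hd.r₂_le φ hφ0)) hB.l_pos hB.drift_le hB.B_eq
    h1 h2 hpos hh1 hh2 hB.rate_lt hcd
  rw [opL_sub A b hud hwd] at hnn
  linarith [hu _ hU]

theorem isCompact_crossSection (r₁ r₂ : ℝ → ℝ) (θ : ℝ) :
    IsCompact (crossSection r₁ r₂ θ) := by
  have : crossSection r₁ r₂ θ = (fun r => polar r θ) '' Set.Icc (r₁ θ) (r₂ θ) := by
    ext x
    constructor
    · rintro ⟨r, h1, h2, rfl⟩
      exact ⟨r, ⟨h1, h2⟩, rfl⟩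
    · rintro ⟨r, ⟨h1, h2⟩, rfl⟩
      exact ⟨r, h1, h2, rfl⟩
  rw [this]
  exact isCompact_Icc.image (continuous_polar.comp (continuous_id.prodMk continuous_const))

theorem crossSection_subset {θ : ℝ} (hθ : θ₀ ≤ θ) :
    crossSection r₁ r₂ θ ⊆ domUtilde θ₀ r₁ r₂ := by
  rintro x ⟨r, h1, h2, rfl⟩
  exact ⟨r, θ, hθ, h1, h2, rfl⟩

theorem IsSpiralData.eventually_abs_le (hd : IsSpiralData c₀ M₁ M₂ rstar R θ₀ r₁ r₂ A b u)
    {ε δ : ℝ} (hε : 0 < ε) (hδ : 0 < δ) :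
    ∀ᶠ θ in Filter.atTop, ∀ r, r₁ θ ≤ r → r ≤ r₂ θ → |u (polar r θ)| ≤ δ * Real.exp (ε * θ) := by
  filter_upwards [(hd.growth ε hε).eventually_lt_const hδ, Filter.eventually_ge_atTop θ₀]
    with θ h1 h2 r hr1 hr2
  -- Needed because `sSup` of an unbounded real set is 0 and would control nothing.
  have hbdd : BddAbove ((fun x => |u x|) '' crossSection r₁ r₂ θ) :=
    ((isCompact_crossSection r₁ r₂ θ).image_of_continuousOn
      (hd.continuousOn.mono (crossSection_subset h2)).abs).bddAbove
  have h3 := le_csSup hbdd (Set.mem_image_of_mem _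
    (show polar r θ ∈ crossSection r₁ r₂ θ from ⟨r, hr1, hr2, rfl⟩))
  refine h3.trans ?_
  have h4 := mul_lt_mul_of_pos_right h1 (Real.exp_pos (ε * θ))
  have h5 : Real.exp (-ε * θ) * Real.exp (ε * θ) = 1 := by
    rw [← Real.exp_add]
    simp
  calc sSup ((fun x => |u x|) '' crossSection r₁ r₂ θ)
      = Real.exp (-ε * θ) * sSup ((fun x => |u x|) '' crossSection r₁ r₂ θ) *
        Real.exp (ε * θ) := by linear_combination (-sSup _) * h5
    _ ≤ δ * Real.exp (ε * θ) := h4.le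

/-- Phragmén–Lindelöf estimate with exponential decay of the influence of the initial section. -/
theorem IsSpiralData.le_add_exp_decay (hd : IsSpiralData c₀ M₁ M₂ rstar R θ₀ r₁ r₂ A b u)
    (hB : BarrierRate c₀ M₁ M₂ rstar R l B ν)
    (hu : ∀ x ∈ domU θ₀ r₁ r₂, opL A b u x ≤ 0) {m N : ℝ} (hmN : m ≤ N)
    (hlat : ∀ x ∈ lateral θ₀ r₁ r₂, u x ≤ m) (hsec : ∀ x ∈ crossSection r₁ r₂ θ₀, u x ≤ N)
    {r θ : ℝ} (hθ : θ₀ ≤ θ) (hr1 : r₁ θ ≤ r) (hr2 : r ≤ r₂ θ) :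
    u (polar r θ) ≤ m + B * (N - m) * Real.exp (-ν * (θ - θ₀)) := by
  have hν := hB.rate_pos
  have hnorm {r θ : ℝ} (h0 : θ₀ ≤ θ) (h1 : r₁ θ ≤ r) (h2 : r ≤ r₂ θ) : ‖polar r θ‖ ≤ R := by
    rw [norm_polar ((hd.spiral.r₁_pos θ h0).le.trans h1)]
    exact h2.trans (hd.r₂_le θ h0)
  have key : ∀ δ : ℝ, 0 < δ → u (polar r θ) ≤
      m + ((N - m) * Real.exp (-ν * (θ - θ₀)) + δ * Real.exp (ν * θ)) * B := by
    intro δ hδ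
    set c := (N - m) * Real.exp (ν * θ₀) with hc
    have hc0 : 0 ≤ c := mul_nonneg (sub_nonneg.2 hmN) (Real.exp_pos _).le
    have hce (t : ℝ) : c * Real.exp (-ν * t) = (N - m) * Real.exp (-ν * (t - θ₀)) := by
      rw [hc, mul_assoc, ← Real.exp_add]
      congr 2
      ring
    have pe (t : ℝ) : 0 ≤ c * Real.exp (-ν * t) := mul_nonneg hc0 (Real.exp_pos _).le
    have pd (t : ℝ) : 0 < δ * Real.exp (ν * t) := mul_pos hδ (Real.exp_pos _)
    -- At T both |u| and |m| are at most (δ/2) e^{νT}, hence u - m ≤ δ e^{νT} on the far section.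
    obtain ⟨T, hT1, hT2, hT3⟩ := ((hd.eventually_abs_le hν (half_pos hδ)).and
      (((Real.tendsto_exp_atTop.comp (Filter.tendsto_id.const_mul_atTop hν)).eventually_ge_atTop
        (|m| / (δ / 2))).and (Filter.eventually_ge_atTop θ))).exists
    have hT2' : |m| ≤ δ / 2 * Real.exp (ν * T) := by
      rw [div_le_iff₀ (half_pos hδ)] at hT2
      simpa [mul_comm] using hT2
    have hmain := hd.le_barrier hB hu (m := m) (T := T)
      (h := fun t => c * Real.exp (-ν * t) + δ * Real.exp (ν * t))
      (h' := fun t => c * -ν * Real.exp (-ν * t) + δ * ν * Real.exp (ν * t))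
      (h'' := fun t => c * -ν * -ν * Real.exp (-ν * t) + δ * ν * ν * Real.exp (ν * t))
      (fun t => (hasDerivAt_exp_const_mul _ _ t).add (hasDerivAt_exp_const_mul _ _ t))
      (fun t => (hasDerivAt_exp_const_mul _ _ t).add (hasDerivAt_exp_const_mul _ _ t))
      (by fun_prop) (fun t => by linarith [pe t, pd t])
      (fun t => by
        have a1 := mul_nonneg hν.le (pe t)
        have a2 := mul_nonneg hν.le (pd t).le
        rw [abs_le]
        constructor <;> linarith)
      -- Here |h''| ≤ ν² h, and ν ≤ 1 turns this into ν h.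
      (fun t => by
        have a1 := mul_nonneg hν.le (pe t)
        have a2 := mul_nonneg hν.le (pd t).le
        have a3 := mul_le_mul_of_nonneg_right hB.rate_le_one a1
        have a4 := mul_le_mul_of_nonneg_right hB.rate_le_one a2
        have a5 := mul_nonneg hν.le a1
        have a6 := mul_nonneg hν.le a2
        rw [abs_le]
        constructor <;> linarith)
      (fun r' θ' b1 b2 b3 b4 hcase => by
        have hw := (weight_bounds hB.l_pos hB.B_eq (hnorm b1 b3 b4)).1
        have hh : 0 ≤ c * Real.exp (-ν * θ') + δ * Real.exp (ν * θ') := by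
          linarith [pe θ', pd θ']
        refine le_trans ?_ (add_le_add_right (le_mul_of_one_le_right hh hw) m)
        rcases hcase with rfl | rfl | h | h
        · have e := hce θ'
          simp only [sub_self, mul_zero, Real.exp_zero, mul_one] at e
          have := hsec _ ⟨r', b3, b4, rfl⟩
          linarith [pd θ']
        · have a1 := (abs_le.1 (hT1 r' b3 b4)).2
          have a2 := (abs_le.1 hT2').1
          linarith [pe θ']
        · have := hlat (polar r' θ') (Or.inl ⟨θ', b1, by rw [h]⟩)
          linarith
        · have := hlat (polar r' θ') (Or.inr ⟨θ', b1, by rw [h]⟩)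
          linarith)
      hθ hT3 hr1 hr2
    refine hmain.trans ?_
    rw [← hce]
    exact add_le_add_right (mul_le_mul_of_nonneg_left
      (weight_bounds hB.l_pos hB.B_eq (hnorm hθ hr1 hr2)).2 (by linarith [pe θ, pd θ])) m
  have hlim : Filter.Tendsto (fun δ : ℝ =>
      m + ((N - m) * Real.exp (-ν * (θ - θ₀)) + δ * Real.exp (ν * θ)) * B) (𝓝[>] 0)
      (𝓝 (m + ((N - m) * Real.exp (-ν * (θ - θ₀)) + 0 * Real.exp (ν * θ)) * B)) := by
    refine Filter.Tendsto.mono_left (Continuous.tendsto ?_ 0) nhdsWithin_le_nhds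
    fun_prop
  have := ge_of_tendsto hlim (eventually_nhdsWithin_of_forall key)
  linarith

end Comparison

/-! ### Suprema, limsup, and passage to -u. -/

section Conclusion

variable {c₀ M₁ M₂ rstar R θ₀ l B ν : ℝ} {r₁ r₂ : ℝ → ℝ}
  {A : Plane → Matrix (Fin 2) (Fin 2) ℝ} {b : Plane → Plane} {u : Plane → ℝ}

theorem IsSpiral.crossSection_nonempty (h : IsSpiral θ₀ r₁ r₂ rstar) {θ : ℝ} (hθ : θ₀ ≤ θ) :
    (crossSection r₁ r₂ θ).Nonempty :=
  ⟨_, r₁ θ, le_rfl, (h.r₁_lt_r₂ θ hθ).le, rfl⟩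

theorem lateral_nonempty (θ₀ : ℝ) (r₁ r₂ : ℝ → ℝ) : (lateral θ₀ r₁ r₂).Nonempty :=
  ⟨_, Or.inl ⟨θ₀, le_rfl, rfl⟩⟩

theorem IsSpiralData.bddAbove_crossSection (hd : IsSpiralData c₀ M₁ M₂ rstar R θ₀ r₁ r₂ A b u)
    {θ : ℝ} (hθ : θ₀ ≤ θ) : BddAbove (u '' crossSection r₁ r₂ θ) :=
  ((isCompact_crossSection r₁ r₂ θ).image_of_continuousOn
    (hd.continuousOn.mono (crossSection_subset hθ))).bddAbove

/-- Beyond some θ₁ the lateral values stay below a number a just above the limsup of the end values.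
Restarting at θ₁ with m = a, the excess over a decays exponentially; the gap a < a' absorbs it. -/
theorem IsSpiralData.limsup_sectionMax_le (hd : IsSpiralData c₀ M₁ M₂ rstar R θ₀ r₁ r₂ A b u)
    (hB : BarrierRate c₀ M₁ M₂ rstar R l B ν) (hu : ∀ x ∈ domU θ₀ r₁ r₂, opL A b u x ≤ 0) :
    Filter.limsup (fun θ : ℝ => (sectionMax r₁ r₂ u θ : EReal)) Filter.atTop ≤
      Filter.limsup (fun θ : ℝ => (endMax r₁ r₂ u θ : EReal)) Filter.atTop := by
  refine le_of_forall_gt_imp_ge_of_dense fun c hc => ?_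
  obtain ⟨a', ha1, ha2⟩ := EReal.lt_iff_exists_real_btwn.1 hc
  obtain ⟨a, ha3, ha4⟩ := EReal.lt_iff_exists_real_btwn.1 ha1
  have haa : a < a' := EReal.coe_lt_coe_iff.1 ha4
  obtain ⟨θ₁, hθ₁⟩ := Filter.eventually_atTop.1
    ((Filter.eventually_lt_of_limsup_lt ha3).and (Filter.eventually_ge_atTop θ₀))
  have h01 : θ₀ ≤ θ₁ := (hθ₁ θ₁ le_rfl).2
  have hd' := hd.mono h01
  have hlat : ∀ x ∈ lateral θ₁ r₁ r₂, u x ≤ a := by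
    rintro x (⟨θ, hθ, rfl⟩ | ⟨θ, hθ, rfl⟩)
    · exact (le_max_left _ _).trans (EReal.coe_lt_coe_iff.1 (hθ₁ θ hθ).1).le
    · exact (le_max_right _ _).trans (EReal.coe_lt_coe_iff.1 (hθ₁ θ hθ).1).le
  set N := max a (sectionMax r₁ r₂ u θ₁) with hN
  have hsec : ∀ x ∈ crossSection r₁ r₂ θ₁, u x ≤ N := fun x hx =>
    (le_csSup (hd.bddAbove_crossSection h01) (Set.mem_image_of_mem u hx)).trans (le_max_right _ _)
  have hlim : Filter.Tendsto (fun θ => a + B * (N - a) * Real.exp (-ν * (θ - θ₁))) Filter.atTop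
      (𝓝 (a + B * (N - a) * 0)) := by
    refine ((Real.tendsto_exp_atBot.comp ?_).const_mul _).const_add _
    refine Filter.Tendsto.const_mul_atTop_of_neg (neg_lt_zero.2 hB.rate_pos) ?_
    exact Filter.tendsto_atTop_add_const_right _ _ Filter.tendsto_id
  rw [mul_zero, add_zero] at hlim
  refine Filter.limsup_le_of_le (h := ?_)
  filter_upwards [hlim.eventually_lt_const haa, Filter.eventually_ge_atTop θ₁] with θ h1 h2
  refine le_trans (EReal.coe_le_coe_iff.2 ?_) ha2.le
  refine csSup_le ((hd'.spiral.crossSection_nonempty h2).image u) ?_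
  rintro _ ⟨x, ⟨r, hr1, hr2, rfl⟩, rfl⟩
  exact (hd'.le_add_exp_decay hB (fun x hx => hu x (domU_mono h01 _ _ hx)) (le_max_left _ _) hlat
    hsec h2 hr1 hr2).trans h1.le

/-- The decay estimate is used twice: with both levels equal to M the exponential disappears and the
maximum principle remains; with lateral level sup over γ it is the weighted bound. -/
theorem IsSpiralData.subsolution_bounds (hd : IsSpiralData c₀ M₁ M₂ rstar R θ₀ r₁ r₂ A b u)
    (hB : BarrierRate c₀ M₁ M₂ rstar R l B ν) (hK : ∃ K : ℝ, ∀ x ∈ lateral θ₀ r₁ r₂, |u x| ≤ K)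
    (hu : ∀ x ∈ domU θ₀ r₁ r₂, opL A b u x ≤ 0) :
    (BddAbove (u '' domUtilde θ₀ r₁ r₂) ∧
      sSup (u '' domUtilde θ₀ r₁ r₂) ≤
        sSup (u '' (crossSection r₁ r₂ θ₀ ∪ lateral θ₀ r₁ r₂))) ∧
    (∀ θ, θ₀ ≤ θ →
      sectionMax r₁ r₂ u θ ≤
        sSup (u '' lateral θ₀ r₁ r₂) * (1 - B * Real.exp (-ν * (θ - θ₀))) +
          B * sSup (u '' (crossSection r₁ r₂ θ₀ ∪ lateral θ₀ r₁ r₂)) *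
            Real.exp (-ν * (θ - θ₀))) ∧
    Filter.limsup (fun θ : ℝ => (sectionMax r₁ r₂ u θ : EReal)) Filter.atTop ≤
      Filter.limsup (fun θ : ℝ => (endMax r₁ r₂ u θ : EReal)) Filter.atTop := by
  obtain ⟨K, hK⟩ := hK
  have hbl : BddAbove (u '' lateral θ₀ r₁ r₂) :=
    ⟨K, by rintro _ ⟨x, hx, rfl⟩; exact (abs_le.1 (hK x hx)).2⟩
  have hbu : BddAbove (u '' (crossSection r₁ r₂ θ₀ ∪ lateral θ₀ r₁ r₂)) := by
    rw [Set.image_union]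
    exact (hd.bddAbove_crossSection le_rfl).union hbl
  set M := sSup (u '' (crossSection r₁ r₂ θ₀ ∪ lateral θ₀ r₁ r₂)) with hM
  set m := sSup (u '' lateral θ₀ r₁ r₂) with hm
  have hmM : m ≤ M := csSup_le_csSup hbu ((lateral_nonempty θ₀ r₁ r₂).image u)
    (Set.image_mono Set.subset_union_right)
  have hlm : ∀ x ∈ lateral θ₀ r₁ r₂, u x ≤ m := fun x hx =>
    le_csSup hbl (Set.mem_image_of_mem u hx)
  have hsM : ∀ x ∈ crossSection r₁ r₂ θ₀, u x ≤ M := fun x hx =>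
    le_csSup hbu (Set.mem_image_of_mem u (Or.inl hx))
  have hall : ∀ y ∈ u '' domUtilde θ₀ r₁ r₂, y ≤ M := by
    rintro _ ⟨x, ⟨r, θ, hθ, hr1, hr2, rfl⟩, rfl⟩
    simpa using hd.le_add_exp_decay hB hu le_rfl (fun x hx => (hlm x hx).trans hmM) hsM hθ hr1 hr2
  refine ⟨⟨⟨M, hall⟩, csSup_le ?_ hall⟩, fun θ hθ => ?_, hd.limsup_sectionMax_le hB hu⟩
  · exact ((hd.spiral.crossSection_nonempty le_rfl).mono (crossSection_subset le_rfl)).image u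
  · refine csSup_le ((hd.spiral.crossSection_nonempty hθ).image u) ?_
    rintro _ ⟨x, ⟨r, hr1, hr2, rfl⟩, rfl⟩
    have := hd.le_add_exp_decay hB hu hmM hlm hsM hθ hr1 hr2
    linarith

theorem IsSpiralData.neg (hd : IsSpiralData c₀ M₁ M₂ rstar R θ₀ r₁ r₂ A b u) :
    IsSpiralData c₀ M₁ M₂ rstar R θ₀ r₁ r₂ A b fun x => -u x :=
  { hd with
    contDiffOn := hd.contDiffOn.neg
    continuousOn := hd.continuousOn.neg
    growth := by simpa only [BelowExpGrowth, abs_neg] using hd.growth }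

/-- No boundedness is required, since the real `sInf` is defined by reflecting `sSup`. -/
theorem sSup_image_neg (u : Plane → ℝ) (s : Set Plane) :
    sSup ((fun x => -u x) '' s) = -sInf (u '' s) := by
  rw [Real.sInf_def, neg_neg, ← Set.image_neg_eq_neg, Set.image_image]

theorem sectionMax_neg (r₁ r₂ : ℝ → ℝ) (u : Plane → ℝ) (θ : ℝ) :
    sectionMax r₁ r₂ (fun x => -u x) θ = -sectionMin r₁ r₂ u θ :=
  sSup_image_neg u _

theorem endMax_neg (r₁ r₂ : ℝ → ℝ) (u : Plane → ℝ) (θ : ℝ) :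
    endMax r₁ r₂ (fun x => -u x) θ = -endMin r₁ r₂ u θ :=
  max_neg_neg _ _

theorem limsup_coe_neg (f : ℝ → ℝ) :
    Filter.limsup (fun θ => ((-f θ : ℝ) : EReal)) Filter.atTop =
      -Filter.liminf (fun θ => (f θ : EReal)) Filter.atTop := by
  rw [← EReal.limsup_neg]
  congr 1

end Conclusion
end SpiralDomain

theorem theorem5p1 (c₀ M₁ M₂ rstar Rbar : ℝ) (hc₀ : 0 < c₀) (hM₁ : 0 < M₁) (hM₂ : 0 ≤ M₂) :
    ∃ Cstar : ℝ, 0 < Cstar ∧ ∃ ν : ℝ, 0 < ν ∧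
      ∀ (θ₀ : ℝ) (r₁ r₂ : ℝ → ℝ), IsSpiral θ₀ r₁ r₂ rstar →
      (∀ θ, θ₀ ≤ θ → r₂ θ ≤ Rbar) →
      ∀ (A : Plane → Matrix (Fin 2) (Fin 2) ℝ) (b : Plane → Plane),
      IsElliptic (domU θ₀ r₁ r₂) A c₀ M₁ →
      (∀ x ∈ domU θ₀ r₁ r₂, ‖b x‖ ≤ M₂) →
      ∀ u : Plane → ℝ,
      ContDiffOn ℝ 2 u (domU θ₀ r₁ r₂) →
      ContinuousOn u (domUtilde θ₀ r₁ r₂) →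
      (∃ K : ℝ, ∀ x ∈ lateral θ₀ r₁ r₂, |u x| ≤ K) →
      BelowExpGrowth r₁ r₂ u →
      ((∀ x ∈ domU θ₀ r₁ r₂, opL A b u x ≤ 0) →
        (BddAbove (u '' domUtilde θ₀ r₁ r₂) ∧
          sSup (u '' domUtilde θ₀ r₁ r₂) ≤
            sSup (u '' (crossSection r₁ r₂ θ₀ ∪ lateral θ₀ r₁ r₂))) ∧
        (∀ θ, θ₀ ≤ θ →
          sectionMax r₁ r₂ u θ ≤
            sSup (u '' lateral θ₀ r₁ r₂) * (1 - Cstar * Real.exp (-ν * (θ - θ₀))) +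
              Cstar * sSup (u '' (crossSection r₁ r₂ θ₀ ∪ lateral θ₀ r₁ r₂)) *
                Real.exp (-ν * (θ - θ₀))) ∧
        Filter.limsup (fun θ : ℝ => (sectionMax r₁ r₂ u θ : EReal)) Filter.atTop ≤
          Filter.limsup (fun θ : ℝ => (endMax r₁ r₂ u θ : EReal)) Filter.atTop) ∧
      ((∀ x ∈ domU θ₀ r₁ r₂, 0 ≤ opL A b u x) →
        (BddBelow (u '' domUtilde θ₀ r₁ r₂) ∧
          sInf (u '' (crossSection r₁ r₂ θ₀ ∪ lateral θ₀ r₁ r₂)) ≤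
            sInf (u '' domUtilde θ₀ r₁ r₂)) ∧
        (∀ θ, θ₀ ≤ θ →
          sInf (u '' lateral θ₀ r₁ r₂) * (1 - Cstar * Real.exp (-ν * (θ - θ₀))) +
              Cstar * sInf (u '' (crossSection r₁ r₂ θ₀ ∪ lateral θ₀ r₁ r₂)) *
                Real.exp (-ν * (θ - θ₀)) ≤
            sectionMin r₁ r₂ u θ) ∧
        Filter.liminf (fun θ : ℝ => (endMin r₁ r₂ u θ : EReal)) Filter.atTop ≤
          Filter.liminf (fun θ : ℝ => (sectionMin r₁ r₂ u θ : EReal)) Filter.atTop) := by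
  -- The constants are chosen before any spiral is given; for r⋆ ≤ 0 there is no spiral and any
  -- positive values do.
  by_cases hr : 0 < rstar
  swap
  · exact ⟨1, one_pos, 1, one_pos, fun θ₀ r₁ r₂ hsp => absurd hsp.rstar_pos hr⟩
  obtain ⟨l, B, ν, hB⟩ := exists_barrierRate Rbar hc₀ hM₁ hM₂ hr
  refine ⟨B, by rw [hB.B_eq]; positivity, ν, hB.rate_pos, ?_⟩
  intro θ₀ r₁ r₂ hsp hR A b hA hb u hu2 hu0 hK hgr
  have hd : IsSpiralData c₀ M₁ M₂ rstar Rbar θ₀ r₁ r₂ A b u :=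
    ⟨hc₀, hsp, hR, hA, hb, hu2, hu0, hgr⟩
  refine ⟨hd.subsolution_bounds hB hK, fun hL => ?_⟩
  obtain ⟨⟨⟨K, h0⟩, h1⟩, h2, h3⟩ := hd.neg.subsolution_bounds hB (by simpa only [abs_neg] using hK)
    (fun x hx => by rw [opL_neg]; exact neg_nonpos.2 (hL x hx))
  simp only [sSup_image_neg, sectionMax_neg, endMax_neg, limsup_coe_neg] at h1 h2 h3
  refine ⟨⟨⟨-K, ?_⟩, neg_le_neg_iff.1 h1⟩, fun θ hθ => ?_, EReal.neg_le_neg_iff.1 h3⟩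
  · rintro _ ⟨x, hx, rfl⟩
    exact neg_le.1 (h0 (Set.mem_image_of_mem _ hx))
  · have := h2 θ hθ
    linarith
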